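/- Let $G$ be a finite plane graph without loops or multiple edges (vertices are distinct points of $\mathbb{R}^2$, edges are simple arcs joining their endpoints, meeting no other vertex, and two different edges meet at most at common endpoints). Assume that $G$ is symmetric about the horizontal line $\ell$: the reflection across $\ell$ maps vertices to vertices and edges to edges. Let $w$ be a weight function on the edges of $G$, with values in a commutative ring $R$ (for instance $R=\mathbb{R}$), that takes the same value on each edge and on its reflection across $\ell$. Let $e_1,\dots,e_s$ be pairwise disjoint edges of $G$ (no two share an endpoint), each having exactly one endpoint on $\ell$; orient each $e_i$ so that it points away from $\ell$, i.e. from its endpoint on $\ell$ to its other endpoint, and let $e_i'$ be the reflection of $e_i$ across $\ell$, with the orientation induced by the reflection. Let $v$ be a vertex of $G$ that lies on $\ell$ and on the boundary of the unbounded face, and is not incident to any of the $e_i$. A spanning tree of $G$ rooted at $v$ is a spanning tree all of whose edges are oriented toward $v$ (that is, along the paths in the tree that lead to $v$); its weight is the product of the weights of its edges. For $I\subseteq[s]=\{1,\dots,s\}$ let $\mathcal{T}^v_{E,I}(G)$ be the set of spanning trees $T$ of $G$ rooted at $v$ that contain the oriented edge $e_i$ for every $i\in I$ and the oriented edge $e_i'$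 for every $i\in[s]\setminus I$. Then the sum of the weights of the spanning trees in $\mathcal{T}^v_{E,I}(G)$ is the same for all $I\subseteq[s]$. -/

import Mathlib

/-- The Euclidean plane, with its usual topology and bounded sets. -/
abbrev Plane : Type := ℝ × ℝ

namespace Plane

/-- Reflection across the horizontal symmetry axis `y = 0`. -/
def reflect (p : Plane) : Plane := (p.1, -p.2)

/-- The horizontal symmetry axis. -/
def axis : Set Plane := {p | p.2 = 0}

theorem reflect_injective : Function.Injective reflect := by
  rintro ⟨a, b⟩ ⟨c, d⟩ h
  simpa [reflect] using h

end Plane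

/-- A drawing without crossings of the simple graph `G` in the plane: a simple graph together with
such a drawing is a plane graph. Distinct vertices are distinct points, every edge is a simple
arc joining its two endpoints, an edge passes through no vertex other than its endpoints, and two
different edges meet at most at common endpoints. -/
structure PlaneDrawing {V : Type*} (G : SimpleGraph V) where
  /-- the point representing a vertex -/
  pos : V → Plane
  /-- the set of points of the arc representing an edge -/
  arc : G.edgeSet → Set Plane
  pos_injective : Function.Injective pos
  arc_isArc : ∀ (u w : V) (h : G.Adj u w),
    ∃ γ : Path (pos u) (pos w), Function.Injective γ ∧
      Set.range γ = arc ⟨s(u, w), G.mem_edgeSet.2 h⟩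
  mem_of_pos_mem_arc : ∀ (e : G.edgeSet) (u : V), pos u ∈ arc e → u ∈ (e : Sym2 V)
  arc_inter : ∀ e f : G.edgeSet, e ≠ f → arc e ∩ arc f ⊆ Set.range pos

namespace PlaneDrawing

variable {V : Type*} {G : SimpleGraph V}

/-- The set of all points of the drawing. -/
def support (D : PlaneDrawing G) : Set Plane := Set.range D.pos ∪ ⋃ e, D.arc e

/-- The faces are the connected components of the complement of the drawing. -/
def IsFace (D : PlaneDrawing G) (F : Set Plane) : Prop :=
  ∃ p ∈ D.supportᶜ, F = connectedComponentIn D.supportᶜ p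

/-- The vertex `v` lies on the boundary of the unbounded face. -/
def OnUnboundedFace (D : PlaneDrawing G) (v : V) : Prop :=
  ∃ F : Set Plane, D.IsFace F ∧ ¬ Bornology.IsBounded F ∧ D.pos v ∈ frontier F

/-- The vertex `u` lies on the symmetry axis. -/
def OnAxis (D : PlaneDrawing G) (u : V) : Prop := D.pos u ∈ Plane.axis

/-- The plane graph is symmetric about the axis: reflection across the axis sends vertices to
vertices and edges (as arcs in the plane) to edges. -/
structure IsSymmetric (D : PlaneDrawing G) : Prop where
  vertex : ∀ u : V, ∃ u₁ : V, D.pos u₁ = Plane.reflect (D.pos u)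
  edge : ∀ e : G.edgeSet, ∃ e₁ : G.edgeSet, D.arc e₁ = Plane.reflect '' D.arc e

/-- A weight function on the edges is symmetric if it takes the same value on every edge and on
the reflection of that edge. -/
def IsSymmetricWeight (D : PlaneDrawing G) {R : Type*} (w : G.edgeSet → R) : Prop :=
  ∀ e e₁ : G.edgeSet, D.arc e₁ = Plane.reflect '' D.arc e → w e₁ = w e

theorem pos_mem_arc (D : PlaneDrawing G) {u w : V} (h : G.Adj u w) :
    D.pos u ∈ D.arc ⟨s(u, w), G.mem_edgeSet.2 h⟩ ∧
      D.pos w ∈ D.arc ⟨s(u, w), G.mem_edgeSet.2 h⟩ := by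
  obtain ⟨γ, -, hγ⟩ := D.arc_isArc u w h
  rw [← hγ]
  exact ⟨⟨0, γ.source⟩, ⟨1, γ.target⟩⟩

namespace IsSymmetric

variable {D : PlaneDrawing G}

/-- The reflection across the axis, as a map on the vertices. -/
noncomputable def reflectVertex (hD : D.IsSymmetric) (u : V) : V := (hD.vertex u).choose

theorem pos_reflectVertex (hD : D.IsSymmetric) (u : V) :
    D.pos (hD.reflectVertex u) = Plane.reflect (D.pos u) := (hD.vertex u).choose_spec

/-- The reflection of the edge `uw` is an edge, with endpoints the reflections of `u` and `w`. -/
theorem arc_reflect (hD : D.IsSymmetric) {u w : V} (h : G.Adj u w) :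
    ∃ h₁ : G.Adj (hD.reflectVertex u) (hD.reflectVertex w),
      D.arc ⟨s(hD.reflectVertex u, hD.reflectVertex w), G.mem_edgeSet.2 h₁⟩ =
        Plane.reflect '' D.arc ⟨s(u, w), G.mem_edgeSet.2 h⟩ := by
  obtain ⟨e₁, he₁⟩ := hD.edge ⟨s(u, w), G.mem_edgeSet.2 h⟩
  obtain ⟨hu, hw⟩ := D.pos_mem_arc h
  have hu₁ : hD.reflectVertex u ∈ (e₁ : Sym2 V) := by
    apply D.mem_of_pos_mem_arc
    rw [he₁, hD.pos_reflectVertex]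
    exact ⟨_, hu, rfl⟩
  have hw₁ : hD.reflectVertex w ∈ (e₁ : Sym2 V) := by
    apply D.mem_of_pos_mem_arc
    rw [he₁, hD.pos_reflectVertex]
    exact ⟨_, hw, rfl⟩
  have hne : hD.reflectVertex u ≠ hD.reflectVertex w := by
    intro heq
    apply h.ne
    apply D.pos_injective
    apply Plane.reflect_injective
    rw [← hD.pos_reflectVertex, ← hD.pos_reflectVertex, heq]
  have hval : (e₁ : Sym2 V) = s(hD.reflectVertex u, hD.reflectVertex w) :=
    (Sym2.mem_and_mem_iff hne).1 ⟨hu₁, hw₁⟩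
  have hadj : G.Adj (hD.reflectVertex u) (hD.reflectVertex w) := by
    rw [← G.mem_edgeSet, ← hval]
    exact e₁.2
  refine ⟨hadj, ?_⟩
  rw [← he₁]
  congr 1
  exact Subtype.ext hval.symm

/-- The reflection of an oriented edge across the axis, with the induced orientation. -/
noncomputable def reflectDart (hD : D.IsSymmetric) (d : G.Dart) : G.Dart :=
  ⟨(hD.reflectVertex d.fst, hD.reflectVertex d.snd), (hD.arc_reflect d.adj).choose⟩

end IsSymmetric

end PlaneDrawing

namespace SimpleGraph

variable {V : Type*}

/-- `T` is a spanning tree of `G` (a subgraph containing all vertices which is a tree). -/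
def IsSpanningTree (G T : SimpleGraph V) : Prop := T ≤ G ∧ T.IsTree

/-- The oriented edge `d` of `G` belongs to the spanning tree `T` rooted at `v`, in which all edges
are oriented toward `v`: the path in `T` from the tail of `d` to `v` exists and has `d` as its
first step. -/
def DartMemRooted (G T : SimpleGraph V) (v : V) (d : G.Dart) : Prop :=
  ∃ (h : T.Adj d.fst d.snd) (p : T.Walk d.snd v), (Walk.cons h p).IsPath

open Classical in
/-- The weight of a spanning subgraph: the product of the weights of its edges. -/
noncomputable def subgraphWeight [Fintype V] {G : SimpleGraph V} {R : Type*} [CommRing R]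
    (w : G.edgeSet → R) (T : SimpleGraph V) : R :=
  ∏ e ∈ Finset.univ.filter (fun e : G.edgeSet => (e : Sym2 V) ∈ T.edgeSet), w e

end SimpleGraph

open Classical in
/-- The set of spanning trees of `G` rooted at `v` which contain the oriented edge `E i` for
`i ∈ I`, and the reflection of `E i` for `i ∉ I`. (The orientation of a rooted spanning tree is
determined by the tree and by the root, so rooted trees are recorded as unoriented trees.) -/
noncomputable def rootedTrees {V : Type*} [Fintype V] {G : SimpleGraph V}
    {D : PlaneDrawing G} (hD : D.IsSymmetric) (v : V) {s : ℕ} (E : Fin s → G.Dart)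
    (I : Finset (Fin s)) : Finset (SimpleGraph V) :=
  {T | G.IsSpanningTree T ∧ (∀ i ∈ I, G.DartMemRooted T v (E i)) ∧
    (∀ i ∉ I, G.DartMemRooted T v (hD.reflectDart (E i)))}

/-!
The weighted count of spanning trees rooted at `v` that contain prescribed oriented edges, one for
each of several tails, is a determinant. By the directed matrix-tree theorem
(`RootedForest.sum_rootedTrees_eq_det`) it is the determinant of the Laplacian in which the row of
`v` is `δ_v` and the row of each prescribed tail `a`, with prescribed head `b`, is a multiple of
`δ_a - δ_b`. The matrix-tree theorem is obtained by expanding the determinant row by row over all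
functions `f : V → V` (each vertex chooses the head of its outgoing edge): a function whose iterates
lead every vertex to `v` contributes determinant `1`, any other function contributes `0`.

Replace one prescribed edge `a → b`, with `a` on the axis, by its reflection `a → b'`. Only the row
of `a` changes, and by a multiple of `δ_{b'} - δ_b`, so the two determinants differ by the
determinant of a matrix whose row `a` is antisymmetric under the reflection. That determinant is
zero (`Matrix.det_eq_zero_of_antisymmetric_row`): the rows of the vertices off the axis commute with
the reflection, because all other prescribed tails and `v` lie on the axis. With `n` vertices
strictly above the axis, the differences of the rows of mirror-image vertices give `n` further
antisymmetric rows, hence `n + 1` rows in the antisymmetric vectors that vanish on the axis, a free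
module of rank `n`. Changing the prescribed edges one at a time gives the result.
-/

/-! ### Vanishing of determinants -/

open Finset in
/-- If more rows than `#U` are supported in the columns `U`, then every permutation meets the zero
block. -/
theorem Matrix.det_eq_zero_of_zero_block {n R : Type*} [Fintype n] [DecidableEq n] [CommRing R]
    (M : Matrix n n R) (S U : Finset n) (hcard : #U < #S)
    (hM : ∀ x ∈ S, ∀ y ∉ U, M x y = 0) : M.det = 0 := by
  rw [← Matrix.det_transpose, Matrix.det_apply]
  refine Finset.sum_eq_zero fun π _ => ?_
  obtain ⟨y, hy, hyU⟩ := Finset.exists_mem_notMem_of_card_lt_card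
    (s := U) (t := S.map π.toEmbedding) (by simpa using hcard)
  obtain ⟨x, hx, rfl⟩ := Finset.mem_map.1 hy
  rw [Finset.prod_eq_zero (Finset.mem_univ x) (by simpa using hM x hx _ hyU), smul_zero]

/-- A determinant that vanishes by symmetry. Here `σ` is an involution, `U` contains one element of
each pair of points exchanged by `σ`, the rows of the moved points are compatible with `σ`, and the
row of a fixed point `a` is antisymmetric. Conjugating by a unipotent matrix, which subtracts the row
of `σ x` from that of `x ∈ U` and adds the column of `y ∈ U` to that of `σ y`, leaves the rows
of `U ∪ {a}` supported in the columns of `U`. -/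
theorem Matrix.det_eq_zero_of_antisymmetric_row {V R : Type*} [Fintype V] [DecidableEq V]
    [CommRing R] (M : Matrix V V R) {σ : V → V} (hσ : Function.Involutive σ) (U : Finset V)
    (hU : ∀ x ∈ U, σ x ∉ U) (hU' : ∀ x ∉ U, σ x ∉ U → σ x = x)
    (hM : ∀ x y, σ x ≠ x → M (σ x) (σ y) = M x y)
    {a : V} (ha : σ a = a) (hMa : ∀ y, M a (σ y) = -M a y)
    -- The next hypothesis is not automatic: `2` may be a zero divisor in `R`.
    (hMa' : ∀ y, σ y = y → M a y = 0) : M.det = 0 := by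
  have hfix : ∀ x ∈ U, σ x ≠ x := fun x hx h => hU x hx (h.symm ▸ hx)
  have haU : a ∉ U := fun h => hfix a h ha
  let Q : Matrix V V R := Matrix.of fun x y => if x ∈ U ∧ y = σ x then 1 else 0
  have hQmul : ∀ (N : Matrix V V R) x y, (Q * N) x y = if x ∈ U then N (σ x) y else 0 := by
    intro N x y
    by_cases hx : x ∈ U <;> simp [Q, Matrix.mul_apply, hx]
  have hmulQ : ∀ (N : Matrix V V R) x y, (N * Q) x y = if σ y ∈ U then N x (σ y) else 0 := by
    intro N x y
    have h1 : ∀ z, (z ∈ U ∧ y = σ z) ↔ (z = σ y ∧ σ y ∈ U) := by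
      intro z
      constructor
      · rintro ⟨h, rfl⟩
        rw [hσ z]; exact ⟨rfl, h⟩
      · rintro ⟨rfl, h⟩
        exact ⟨h, (hσ y).symm⟩
    by_cases hy : σ y ∈ U <;> simp [Q, Matrix.mul_apply, h1, hy]
  have hQQ : Q * Q = 0 := by
    ext x y
    rw [hQmul]
    split_ifs with h
    · simp [Q, hU x h]
    · rfl
  have hinv : (1 - Q) * (1 + Q) = 1 := by
    rw [sub_mul, mul_add, mul_add, hQQ]; simp
  have hdet : ((1 - Q) * M * (1 + Q)).det = M.det := by
    rw [Matrix.det_mul, Matrix.det_mul, mul_right_comm, ← Matrix.det_mul, hinv, Matrix.det_one,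
      one_mul]
  rw [← hdet]
  refine Matrix.det_eq_zero_of_zero_block _ (insert a U) U
    (by rw [Finset.card_insert_of_notMem haU]; exact Nat.lt_succ_self _) ?_
  intro x hx y hy
  rw [mul_add, mul_one, Matrix.add_apply, hmulQ]
  simp only [sub_mul, one_mul, Matrix.sub_apply, hQmul]
  rcases Finset.mem_insert.1 hx with rfl | hxU
  · by_cases hyU : σ y ∈ U
    · simp [haU, hyU, hMa]
    · simp [haU, hyU, hMa' y (hU' y hy hyU)]
  · have h1 := hM x y (hfix x hxU)
    by_cases hyU : σ y ∈ U
    · have h2 := hM x (σ y) (hfix x hxU)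
      rw [hσ y] at h2
      simp [hxU, hyU, h1, h2]
    · rw [hU' y hy hyU] at h1
      simp [hxU, hyU, h1]

/-! ### The matrix-tree theorem for functions -/

namespace RootedForest

section Functions

variable {V R : Type*} [CommRing R]

/-- The iterates of `f` lead from every point to `v`. With `f v = v`, this says that `f` is the
parent function of a tree rooted at `v`. -/
def ReachesRoot (f : V → V) (v : V) : Prop := ∀ x, ∃ k, f^[k] x = v

/-- The only periodic point of a parent function is the root. -/
theorem ReachesRoot.eq_root_of_iterate_eq {f : V → V} {v : V} (hf : ReachesRoot f v)
    (hv : f v = v) {x : V} {j : ℕ} (h : f^[j + 1] x = x) : x = v := by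
  obtain ⟨k, hk⟩ := hf x
  have h1 : f^[(j + 1) * k] x = x := by
    rw [Function.iterate_mul]
    exact Function.iterate_fixed h k
  have h2 : f^[j * k + k] x = v := by
    rw [Function.iterate_add_apply, hk]
    exact Function.iterate_fixed hv _
  rw [← h1, ← h2]
  congr 2
  ring

variable [DecidableEq V]

/-- The row `δ_x - δ_z` of the oriented edge `x → z`, except that the row of the root `v` is `δ_v`
whatever `z` is: this keeps all matrices square with index type `V`. -/
def incidenceRow (v x z : V) : V → R :=
  if x = v then Pi.single v 1 else Pi.single x 1 - Pi.single z 1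

variable [Fintype V]

theorem det_incidenceRow_of_reachesRoot {f : V → V} {v : V} (hf : ReachesRoot f v)
    (hv : f v = v) : (Matrix.of fun x => (incidenceRow v x (f x) : V → R)).det = 1 := by
  classical
  rw [← Matrix.det_transpose, Matrix.det_apply, Finset.sum_eq_single 1]
  · have : ∀ x, (incidenceRow v x (f x) : V → R) x = 1 := by
      intro x
      by_cases hx : x = v
      · simp [incidenceRow, hx]
      · have : f x ≠ x := fun h => hx (hf.eq_root_of_iterate_eq hv (j := 0) h)
        simp [incidenceRow, hx, this.symm]
    simp [this]
  · intro π _ hπ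
    by_contra hne
    -- A permutation with nonzero term sends each moved `x` to `f x`, so that its moved points
    -- are closed under `f`; they would then include `v`, which is not moved.
    have hall : ∀ x, (incidenceRow v x (f x) : V → R) (π x) ≠ 0 := by
      intro x hx
      apply hne
      rw [Finset.prod_eq_zero (Finset.mem_univ x) (by simpa using hx), smul_zero]
    have hstep : ∀ x, π x ≠ x → x ≠ v ∧ π x = f x := by
      intro x hx
      have h := hall x
      by_cases hxv : x = v
      · subst hxv
        simp [incidenceRow, hx] at h
      · refine ⟨hxv, ?_⟩
        by_contra hfx
        simp [incidenceRow, hxv, hx, hfx] at h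
    obtain ⟨x, hx⟩ : ∃ x, π x ≠ x := by
      by_contra! h
      exact hπ (Equiv.ext h)
    have hiter : ∀ k, π (f^[k] x) ≠ f^[k] x := by
      intro k
      induction k with
      | zero => exact hx
      | succ k ih =>
        rw [Function.iterate_succ_apply', ← (hstep _ ih).2]
        exact fun h => ih (π.injective h)
    obtain ⟨k, hk⟩ := hf x
    exact (hstep _ (hiter k)).1 hk
  · simp

theorem det_incidenceRow_of_not_reachesRoot {f : V → V} {v : V} (hf : ¬ ReachesRoot f v) :
    (Matrix.of fun x => (incidenceRow v x (f x) : V → R)).det = 0 := by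
  classical
  obtain ⟨x₀, hx₀⟩ := not_forall.1 hf
  set M : Matrix V V R := Matrix.of fun x => incidenceRow v x (f x)
  -- The indicator of the points that never reach `v` is a nonzero kernel vector.
  let u : V → R := fun x => if ∃ k, f^[k] x = v then 0 else 1
  have hu : M.mulVec u = 0 := by
    ext x
    by_cases hx : x = v
    · have : ∃ k, f^[k] v = v := ⟨0, rfl⟩
      simp [M, Matrix.mulVec, incidenceRow, hx, u, this]
    · have hiff : (∃ k, f^[k] (f x) = v) ↔ ∃ k, f^[k] x = v := by
        constructor
        · rintro ⟨k, hk⟩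
          exact ⟨k + 1, hk⟩
        · rintro ⟨_ | k, hk⟩
          · exact absurd hk hx
          · exact ⟨k, hk⟩
      change (incidenceRow v x (f x) : V → R) ⬝ᵥ u = 0
      rw [incidenceRow, if_neg hx, sub_dotProduct]
      simp [u, hiff]
  have h : (M.adjugate * M).mulVec u = 0 := by
    rw [← Matrix.mulVec_mulVec, hu, Matrix.mulVec_zero]
  rw [Matrix.adjugate_mul, Matrix.smul_mulVec, Matrix.one_mulVec] at h
  simpa [u, hx₀] using congrFun h x₀

/-- The Laplacian of the digraph with weight `c x z` on `x → z`, with row `x` equal to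
`∑ z, c x z • (δ_x - δ_z)` for `x ≠ v`. The row of `v` is `(∑ z, c v z) • δ_v`; it is `δ_v`
for the weights `prescribedWeight` used below. -/
def rootedLaplacian (c : V → V → R) (v : V) : Matrix V V R :=
  Matrix.of fun x => ∑ z, c x z • incidenceRow v x z

open Classical in
/-- The directed matrix-tree theorem, stated for parent functions instead of trees. -/
theorem det_rootedLaplacian (c : V → V → R) {v : V} (hc : ∀ z, z ≠ v → c v z = 0) :
    (rootedLaplacian c v).det =
      ∑ f : V → V with f v = v ∧ ReachesRoot f v, ∏ x, c x (f x) := by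
  have h : (rootedLaplacian c v).det = ∑ f : V → V,
      (∏ x, c x (f x)) * (Matrix.of fun x => (incidenceRow v x (f x) : V → R)).det := by
    have h1 := (Matrix.detRowAlternating (R := R) (n := V)).toMultilinearMap.map_sum
      (fun x z => c x z • incidenceRow v x z)
    refine h1.trans (Finset.sum_congr rfl fun f _ => ?_)
    exact (Matrix.detRowAlternating (R := R) (n := V)).toMultilinearMap.map_smul_univ
      (fun x => c x (f x)) (fun x => incidenceRow v x (f x))
  rw [h, Finset.sum_filter]
  refine Finset.sum_congr rfl fun f _ => ?_
  by_cases hv : f v = v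
  · by_cases hf : ReachesRoot f v
    · simp [hv, hf, det_incidenceRow_of_reachesRoot hf hv]
    · simp [hf, det_incidenceRow_of_not_reachesRoot hf]
  · rw [Finset.prod_eq_zero (i := v) (Finset.mem_univ v) (hc (f v) hv)]
    simp [hv]

end Functions

/-! ### Rooted trees and parent functions -/

section Trees

variable {V : Type*} {f : V → V} {v : V}

/-- The graph with an edge between `x` and `f x` for each `x ≠ v`. -/
def parentGraph (f : V → V) (v : V) : SimpleGraph V :=
  SimpleGraph.fromRel fun x y => x ≠ v ∧ f x = y

theorem ReachesRoot.apply_ne (hf : ReachesRoot f v) (hv : f v = v) {x : V} (hx : x ≠ v) :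
    f x ≠ x := fun h => hx (hf.eq_root_of_iterate_eq hv (j := 0) h)

theorem parentGraph_adj_apply (hf : ReachesRoot f v) (hv : f v = v) {x : V} (hx : x ≠ v) :
    (parentGraph f v).Adj x (f x) :=
  (SimpleGraph.fromRel_adj _ _ _).2 ⟨(hf.apply_ne hv hx).symm, Or.inl ⟨hx, rfl⟩⟩

theorem mem_edgeSet_parentGraph (hf : ReachesRoot f v) (hv : f v = v) (e : Sym2 V) :
    e ∈ (parentGraph f v).edgeSet ↔ ∃ x, x ≠ v ∧ s(x, f x) = e := by
  constructor
  · induction e using Sym2.ind with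
    | _ x y =>
      intro h
      rw [SimpleGraph.mem_edgeSet] at h
      obtain ⟨-, ⟨hx, rfl⟩ | ⟨hy, rfl⟩⟩ := (SimpleGraph.fromRel_adj _ _ _).1 h
      · exact ⟨x, hx, rfl⟩
      · exact ⟨y, hy, Sym2.eq_swap⟩
  · rintro ⟨x, hx, rfl⟩
    exact parentGraph_adj_apply hf hv hx

theorem ReachesRoot.parentEdge_injOn (hf : ReachesRoot f v) (hv : f v = v) :
    Set.InjOn (fun x => s(x, f x)) {x | x ≠ v} := by
  intro x hx y _ h
  rcases Sym2.eq_iff.1 h with ⟨h, -⟩ | ⟨h1, h2⟩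
  · exact h
  · refine absurd (hf.eq_root_of_iterate_eq hv (j := 1) ?_) hx
    rw [Function.iterate_succ_apply', Function.iterate_one, h2, ← h1]

/-- The iterates of `f` trace a path from `x` to `v`. -/
theorem parentGraph_exists_isPath (hf : ReachesRoot f v) (hv : f v = v) (x : V) :
    ∃ p : (parentGraph f v).Walk x v, p.IsPath ∧ ∀ y ∈ p.support, ∃ j, f^[j] x = y := by
  obtain ⟨k, hk⟩ := hf x
  induction k generalizing x with
  | zero =>
    obtain rfl : x = v := hk
    exact ⟨.nil, .nil, fun y hy => ⟨0, (List.mem_singleton.1 hy).symm⟩⟩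
  | succ k ih =>
    by_cases hx : x = v
    · subst hx
      exact ⟨.nil, .nil, fun y hy => ⟨0, (List.mem_singleton.1 hy).symm⟩⟩
    · obtain ⟨p, hp, hsupp⟩ := ih (f x) hk
      refine ⟨.cons (parentGraph_adj_apply hf hv hx) p, hp.cons fun hmem => ?_, ?_⟩
      · obtain ⟨j, hj⟩ := hsupp x hmem
        exact hx (hf.eq_root_of_iterate_eq hv hj)
      · intro y hy
        rw [SimpleGraph.Walk.support_cons, List.mem_cons] at hy
        rcases hy with rfl | hy
        · exact ⟨0, rfl⟩
        · obtain ⟨j, hj⟩ := hsupp y hy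
          exact ⟨j + 1, hj⟩

theorem parentGraph_connected (hf : ReachesRoot f v) (hv : f v = v) :
    (parentGraph f v).Connected := by
  have : Nonempty V := ⟨v⟩
  refine ⟨fun x y => ?_⟩
  obtain ⟨p, -⟩ := parentGraph_exists_isPath hf hv x
  obtain ⟨q, -⟩ := parentGraph_exists_isPath hf hv y
  exact ⟨p.append q.reverse⟩

theorem parentGraph_isTree [Finite V] (hf : ReachesRoot f v) (hv : f v = v) :
    (parentGraph f v).IsTree := by
  classical
  have := Fintype.ofFinite V
  have hconn := parentGraph_connected hf hv
  refine SimpleGraph.isTree_iff_connected_and_card.2 ⟨hconn, le_antisymm ?_ ?_⟩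
  · have h : (parentGraph f v).edgeSet = (fun x => s(x, f x)) '' {x | x ≠ v} := by
      ext e
      exact mem_edgeSet_parentGraph hf hv e
    rw [h, Nat.card_image_of_injOn (hf.parentEdge_injOn hv)]
    have hc : Nat.card {x : V | x ≠ v} = Fintype.card V - 1 := by
      rw [Nat.card_eq_fintype_card]
      exact Set.card_ne_eq v
    have := Fintype.card_pos_iff.2 ⟨v⟩
    rw [hc, Nat.card_eq_fintype_card]
    omega
  · exact hconn.card_vert_le_card_edgeSet_add_one

/-- In the tree of a parent function `f`, the edges oriented toward the root are the `x → f x`. -/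
theorem dartMemRooted_parentGraph [Finite V] {G : SimpleGraph V} (hf : ReachesRoot f v)
    (hv : f v = v) (d : G.Dart) :
    G.DartMemRooted (parentGraph f v) v d ↔ d.fst ≠ v ∧ f d.fst = d.snd := by
  have hacyc := (parentGraph_isTree hf hv).isAcyclic
  have hcons : ∀ {x : V}, x ≠ v → ∃ (h : (parentGraph f v).Adj x (f x))
      (p : (parentGraph f v).Walk (f x) v), (SimpleGraph.Walk.cons h p).IsPath := by
    intro x hx
    obtain ⟨p, hp, hsupp⟩ := parentGraph_exists_isPath hf hv (f x)
    refine ⟨parentGraph_adj_apply hf hv hx, p, hp.cons fun hmem => ?_⟩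
    obtain ⟨j, hj⟩ := hsupp x hmem
    exact hx (hf.eq_root_of_iterate_eq hv hj)
  constructor
  · rintro ⟨h, p, hp⟩
    have hne : d.fst ≠ v := fun heq =>
      ((SimpleGraph.Walk.cons_isPath_iff _ _).1 hp).2 (heq ▸ p.end_mem_support)
    refine ⟨hne, ?_⟩
    obtain ⟨h', q, hq⟩ := hcons hne
    have := congrArg (fun r => r.1.snd) ((hacyc.subsingleton_path _ _).elim ⟨_, hq⟩ ⟨_, hp⟩)
    simpa using this
  · rintro ⟨hne, heq⟩
    obtain ⟨h', q, hq⟩ := hcons hne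
    unfold SimpleGraph.DartMemRooted
    rw [← heq]
    exact ⟨h', q, hq⟩

/-- Every tree is given by a parent function: send `x` to a neighbour closer to `v`. -/
theorem exists_parentGraph_eq {T : SimpleGraph V} (hT : T.IsTree) (v : V) :
    ∃ f : V → V, f v = v ∧ ReachesRoot f v ∧ parentGraph f v = T := by
  classical
  have hstep : ∀ x, x ≠ v → ∃ y, T.Adj x y ∧ T.dist y v < T.dist x v := by
    intro x hx
    obtain ⟨p, hp⟩ := hT.connected.exists_walk_length_eq_dist x v
    cases p with
    | nil => exact absurd rfl hx
    | cons h q =>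
      refine ⟨_, h, lt_of_le_of_lt (SimpleGraph.dist_le q) ?_⟩
      rw [← hp]
      simp
  choose! g hadj hdist using hstep
  let f : V → V := fun x => if x = v then v else g x
  have hfv : f v = v := if_pos rfl
  have hfg : ∀ x, x ≠ v → f x = g x := fun x hx => if_neg hx
  have hreach : ReachesRoot f v := by
    intro x
    induction hn : T.dist x v using Nat.strong_induction_on generalizing x with
    | _ n ih =>
      by_cases hx : x = v
      · exact ⟨0, hx⟩
      · obtain ⟨k, hk⟩ := ih _ (hn ▸ hdist x hx) (g x) rfl
        exact ⟨k + 1, by rw [Function.iterate_succ_apply, hfg x hx, hk]⟩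
  refine ⟨f, hfv, hreach, ?_⟩
  have hle : parentGraph f v ≤ T := by
    intro x y h
    obtain ⟨-, ⟨hx, rfl⟩ | ⟨hy, rfl⟩⟩ := (SimpleGraph.fromRel_adj _ _ _).1 h
    · rw [hfg x hx]; exact hadj x hx
    · rw [hfg y hy]; exact (hadj y hy).symm
  exact ((SimpleGraph.isTree_iff_minimal_connected.1 hT).eq_of_ge
    (parentGraph_connected hreach hfv) hle).symm

/-! ### Trees with prescribed oriented edges -/

variable {R : Type*} [CommRing R]

open Classical in
/-- The edge weight `w` as a function of two vertices, zero if they are not adjacent. -/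
noncomputable def adjWeight {G : SimpleGraph V} (w : G.edgeSet → R) (x y : V) : R :=
  if h : G.Adj x y then w ⟨s(x, y), G.mem_edgeSet.2 h⟩ else 0

theorem subgraphWeight_parentGraph [Fintype V] [DecidableEq V] {G : SimpleGraph V}
    (w : G.edgeSet → R)
    (hf : ReachesRoot f v) (hv : f v = v) (hG : ∀ x, x ≠ v → G.Adj x (f x)) :
    SimpleGraph.subgraphWeight w (parentGraph f v) =
      ∏ x ∈ Finset.univ.erase v, adjWeight w x (f x) := by
  symm
  unfold SimpleGraph.subgraphWeight
  refine Finset.prod_bij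
    (fun x hx => ⟨s(x, f x), G.mem_edgeSet.2 (hG x (Finset.ne_of_mem_erase hx))⟩) ?_ ?_ ?_ ?_
  · intro x hx
    simpa using parentGraph_adj_apply hf hv (Finset.ne_of_mem_erase hx)
  · intro x hx y hy h
    exact hf.parentEdge_injOn hv (Finset.ne_of_mem_erase hx) (Finset.ne_of_mem_erase hy)
      (congrArg Subtype.val h)
  · rintro ⟨e, he⟩ h
    obtain ⟨x, hx, rfl⟩ := (mem_edgeSet_parentGraph hf hv e).1 (by simpa using h)
    exact ⟨x, by simpa using hx, rfl⟩
  · intro x hx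
    rw [adjWeight, dif_pos (hG x (Finset.ne_of_mem_erase hx))]

open Classical in
/-- The weight of `x → y` when the darts in `S` are prescribed: a vertex that is the tail of some
`d ∈ S` may only choose the head of `d`. The root `v` carries a loop of weight `1`. -/
noncomputable def prescribedWeight {G : SimpleGraph V} (w : G.edgeSet → R) (v : V)
    (S : Set G.Dart) (x y : V) : R :=
  if x = v then (if y = v then 1 else 0)
  else if ∀ d ∈ S, d.fst = x → d.snd = y then adjWeight w x y else 0

theorem prod_prescribedWeight [Fintype V] {G : SimpleGraph V} (w : G.edgeSet → R)
    {S : Set G.Dart} (hf : ReachesRoot f v) (hv : f v = v) (hG : ∀ x, x ≠ v → G.Adj x (f x))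
    (hfS : ∀ d ∈ S, f d.fst = d.snd) :
    ∏ x, prescribedWeight w v S x (f x) = SimpleGraph.subgraphWeight w (parentGraph f v) := by
  classical
  rw [subgraphWeight_parentGraph w hf hv hG, ← Finset.mul_prod_erase _ _ (Finset.mem_univ v)]
  have h1 : prescribedWeight w v S v (f v) = 1 := by simp [prescribedWeight, hv]
  rw [h1, one_mul]
  refine Finset.prod_congr rfl fun x hx => ?_
  rw [prescribedWeight, if_neg (Finset.ne_of_mem_erase hx), if_pos]
  rintro d hd rfl
  exact (hfS d hd).symm

/-- The matrix-tree theorem for spanning trees rooted at `v` containing the darts in `S`. The set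
of trees is an arbitrary `Finset` with the stated members, so that the choice of decidability
instances plays no role. -/
theorem sum_rootedTrees_eq_det [Fintype V] [DecidableEq V] {G : SimpleGraph V}
    (w : G.edgeSet → R) (v : V) (S : Set G.Dart) (hS : ∀ d ∈ S, d.fst ≠ v)
    (𝒯 : Finset (SimpleGraph V))
    (h𝒯 : ∀ T, T ∈ 𝒯 ↔ G.IsSpanningTree T ∧ ∀ d ∈ S, G.DartMemRooted T v d) :
    ∑ T ∈ 𝒯, SimpleGraph.subgraphWeight w T = (rootedLaplacian (prescribedWeight w v S) v).det := by
  classical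
  rw [det_rootedLaplacian]
  swap
  · intro z hz
    simp [prescribedWeight, hz]
  symm
  have hadj : ∀ f : V → V, ∏ x, prescribedWeight w v S x (f x) ≠ 0 → ∀ x, x ≠ v →
      (∀ d ∈ S, d.fst = x → d.snd = f x) ∧ G.Adj x (f x) := by
    intro f hne x hx
    have h : prescribedWeight w v S x (f x) ≠ 0 :=
      fun h => hne (Finset.prod_eq_zero (i := x) (Finset.mem_univ x) h)
    rw [prescribedWeight, if_neg hx] at h
    split_ifs at h with h1
    · exact ⟨h1, by_contra fun h2 => h (dif_neg h2)⟩
    · exact absurd rfl h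
  refine Finset.sum_bij_ne_zero (fun f _ _ => parentGraph f v) ?_ ?_ ?_ ?_
  · intro f hmem hne
    obtain ⟨hv, hf⟩ := (Finset.mem_filter.1 hmem).2
    refine (h𝒯 _).2 ⟨⟨?_, parentGraph_isTree hf hv⟩, ?_⟩
    · intro x y h
      obtain ⟨-, ⟨hx, rfl⟩ | ⟨hy, rfl⟩⟩ := (SimpleGraph.fromRel_adj _ _ _).1 h
      · exact (hadj f hne x hx).2
      · exact (hadj f hne y hy).2.symm
    · intro d hd
      exact (dartMemRooted_parentGraph hf hv d).2
        ⟨hS d hd, ((hadj f hne _ (hS d hd)).1 d hd rfl).symm⟩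
  · intro f hmem hne g hmem' hne' heq
    obtain ⟨hv, hf⟩ := (Finset.mem_filter.1 hmem).2
    obtain ⟨hv', hg⟩ := (Finset.mem_filter.1 hmem').2
    ext x
    by_cases hx : x = v
    · rw [hx, hv, hv']
    · let d : G.Dart := ⟨(x, f x), (hadj f hne x hx).2⟩
      have h : G.DartMemRooted (parentGraph f v) v d :=
        (dartMemRooted_parentGraph hf hv d).2 ⟨hx, rfl⟩
      rw [show parentGraph f v = parentGraph g v from heq] at h
      exact ((dartMemRooted_parentGraph hg hv' d).1 h).2.symm
  · intro T hmem hne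
    obtain ⟨⟨hTG, hT⟩, hTS⟩ := (h𝒯 T).1 hmem
    obtain ⟨f, hv, hf, rfl⟩ := exists_parentGraph_eq hT v
    refine ⟨f, Finset.mem_filter.2 ⟨Finset.mem_univ _, hv, hf⟩, ?_, rfl⟩
    rwa [prod_prescribedWeight w hf hv
      (fun x hx => hTG (parentGraph_adj_apply hf hv hx))
      (fun d hd => ((dartMemRooted_parentGraph hf hv d).1 (hTS d hd)).2)]
  · intro f hmem hne
    obtain ⟨hv, hf⟩ := (Finset.mem_filter.1 hmem).2
    exact prod_prescribedWeight w hf hv (fun x hx => (hadj f hne x hx).2)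
      (fun d hd => ((hadj f hne _ (hS d hd)).1 d hd rfl).symm)

end Trees

end RootedForest

/-! ### Exchanging a prescribed edge with its reflection -/

namespace PlaneDrawing.IsSymmetric

variable {V : Type*} {G : SimpleGraph V} {D : PlaneDrawing G}

theorem reflectVertex_involutive (hD : D.IsSymmetric) :
    Function.Involutive hD.reflectVertex := by
  intro u
  apply D.pos_injective
  rw [hD.pos_reflectVertex, hD.pos_reflectVertex]
  simp [Plane.reflect]

theorem reflectVertex_eq_self_iff (hD : D.IsSymmetric) (u : V) :
    hD.reflectVertex u = u ↔ D.OnAxis u := by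
  rw [← D.pos_injective.eq_iff, hD.pos_reflectVertex]
  simp [Plane.reflect, OnAxis, Plane.axis, Prod.ext_iff, neg_eq_self]

theorem adjWeight_reflectVertex (hD : D.IsSymmetric) {R : Type*} [CommRing R]
    {w : G.edgeSet → R} (hw : D.IsSymmetricWeight w) (x y : V) :
    RootedForest.adjWeight w (hD.reflectVertex x) (hD.reflectVertex y) =
      RootedForest.adjWeight w x y := by
  by_cases h : G.Adj x y
  · obtain ⟨h₁, harc⟩ := hD.arc_reflect h
    rw [RootedForest.adjWeight, RootedForest.adjWeight, dif_pos h, dif_pos h₁]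
    exact hw _ _ harc
  · have h₁ : ¬ G.Adj (hD.reflectVertex x) (hD.reflectVertex y) := by
      intro h'
      obtain ⟨h₂, -⟩ := hD.arc_reflect h'
      rw [hD.reflectVertex_involutive, hD.reflectVertex_involutive] at h₂
      exact h h₂
    rw [RootedForest.adjWeight, RootedForest.adjWeight, dif_neg h, dif_neg h₁]

end PlaneDrawing.IsSymmetric

namespace RootedForest

variable {V R : Type*} [CommRing R] [Fintype V] [DecidableEq V] {G : SimpleGraph V}

theorem rootedLaplacian_prescribedWeight_of_mem (w : G.edgeSet → R) {v : V} {S : Set G.Dart}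
    {d : G.Dart} (hdv : d.fst ≠ v) (hd : d ∈ S)
    (huniq : ∀ d' ∈ S, d'.fst = d.fst → d' = d) :
    rootedLaplacian (prescribedWeight w v S) v d.fst =
      adjWeight w d.fst d.snd • (Pi.single d.fst 1 - Pi.single d.snd 1) := by
  have h : ∀ z, prescribedWeight w v S d.fst z =
      if z = d.snd then adjWeight w d.fst d.snd else 0 := by
    intro z
    rw [prescribedWeight, if_neg hdv]
    by_cases hz : z = d.snd
    · subst hz
      rw [if_pos rfl, if_pos]
      intro d' hd' heq
      rw [huniq d' hd' heq]
    · rw [if_neg hz, if_neg]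
      exact fun h => hz (h d hd rfl).symm
  change ∑ z, _ • incidenceRow v d.fst z = _
  simp [h, incidenceRow, hdv]

theorem rootedLaplacian_prescribedWeight_congr (w : G.edgeSet → R) {v : V} {S S' : Set G.Dart}
    {x : V} (h : ∀ d : G.Dart, d.fst = x → (d ∈ S ↔ d ∈ S')) :
    rootedLaplacian (prescribedWeight w v S) v x =
      rootedLaplacian (prescribedWeight w v S') v x := by
  have h' : (∀ z, (∀ d ∈ S, d.fst = x → d.snd = z) ↔ (∀ d ∈ S', d.fst = x → d.snd = z)) :=
    fun z => forall_congr' fun d =>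
      ⟨fun H hd hx => H ((h d hx).2 hd) hx, fun H hd hx => H ((h d hx).1 hd) hx⟩
  change ∑ z, _ • incidenceRow v x z = ∑ z, _ • incidenceRow v x z
  refine Finset.sum_congr rfl fun z _ => ?_
  congr 1
  unfold prescribedWeight
  by_cases hx : x = v
  · rw [if_pos hx, if_pos hx]
  rw [if_neg hx, if_neg hx]
  by_cases hz : ∀ d ∈ S, d.fst = x → d.snd = z
  · rw [if_pos hz, if_pos ((h' z).1 hz)]
  · rw [if_neg hz, if_neg (mt (h' z).2 hz)]

theorem rootedLaplacian_apply_of_ne (w : G.edgeSet → R) {v : V} {S : Set G.Dart}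
    {x : V} (hx : x ≠ v) (hxS : ∀ d ∈ S, d.fst ≠ x) (y : V) :
    rootedLaplacian (prescribedWeight w v S) v x y =
      ∑ z, adjWeight w x z * ((if y = x then 1 else 0) - (if y = z then 1 else 0)) := by
  have h : ∀ z, prescribedWeight w v S x z = adjWeight w x z := by
    intro z
    rw [prescribedWeight, if_neg hx, if_pos]
    exact fun d hd hdx => absurd hdx (hxS d hd)
  simp [rootedLaplacian, incidenceRow, hx, h, Pi.single_apply]

/-- Away from the axis no edge is prescribed, so there the Laplacian commutes with the reflection. -/
theorem rootedLaplacian_reflectVertex {D : PlaneDrawing G} (hD : D.IsSymmetric)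
    {w : G.edgeSet → R} (hw : D.IsSymmetricWeight w) {v : V} (hv : D.OnAxis v) {S : Set G.Dart}
    (hS : ∀ d ∈ S, D.OnAxis d.fst) {x : V} (hx : hD.reflectVertex x ≠ x) (y : V) :
    rootedLaplacian (prescribedWeight w v S) v (hD.reflectVertex x) (hD.reflectVertex y) =
      rootedLaplacian (prescribedWeight w v S) v x y := by
  have hσ := hD.reflectVertex_involutive
  have hne : ∀ {x u : V}, hD.reflectVertex x ≠ x → D.OnAxis u → u ≠ x := by
    rintro x _ hx hu rfl
    exact hx ((hD.reflectVertex_eq_self_iff _).2 hu)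
  have hx' : hD.reflectVertex (hD.reflectVertex x) ≠ hD.reflectVertex x :=
    fun h => hx (hσ.injective h)
  rw [rootedLaplacian_apply_of_ne w (hne hx' hv).symm fun d hd => hne hx' (hS d hd),
    rootedLaplacian_apply_of_ne w (hne hx hv).symm fun d hd => hne hx (hS d hd),
    ← Equiv.sum_comp (hσ.toPerm _)]
  refine Finset.sum_congr rfl fun z _ => ?_
  simp only [Function.Involutive.coe_toPerm, hσ.injective.eq_iff, hD.adjWeight_reflectVertex hw]

/-- Replacing one prescribed dart `d`, with tail on the axis, by its reflection does not change the
determinant: the difference is a determinant with an antisymmetric row. -/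
theorem det_rootedLaplacian_reflectDart {D : PlaneDrawing G} (hD : D.IsSymmetric)
    {w : G.edgeSet → R} (hw : D.IsSymmetricWeight w) {v : V} (hv : D.OnAxis v) {S : Set G.Dart}
    (hS : ∀ d ∈ S, D.OnAxis d.fst) {d : G.Dart} (hd : D.OnAxis d.fst) (hdv : d.fst ≠ v)
    (hdS : ∀ d' ∈ S, d'.fst ≠ d.fst) :
    (rootedLaplacian (prescribedWeight w v (insert d S)) v).det =
      (rootedLaplacian (prescribedWeight w v (insert (hD.reflectDart d) S)) v).det := by
  have hσ := hD.reflectVertex_involutive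
  have ha : hD.reflectVertex d.fst = d.fst := (hD.reflectVertex_eq_self_iff _).2 hd
  have ha' : (hD.reflectDart d).fst = d.fst := ha
  have hκ : adjWeight w d.fst (hD.reflectVertex d.snd) = adjWeight w d.fst d.snd := by
    rw [← hD.adjWeight_reflectVertex hw d.fst d.snd, ha]
  set M := rootedLaplacian (prescribedWeight w v S) v with hMdef
  set κ := adjWeight w d.fst d.snd
  have h1 : rootedLaplacian (prescribedWeight w v (insert d S)) v =
      M.updateRow d.fst (κ • (Pi.single d.fst 1 - Pi.single d.snd 1)) := by
    funext x
    by_cases hx : x = d.fst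
    · subst hx
      rw [Matrix.updateRow_self]
      exact rootedLaplacian_prescribedWeight_of_mem w hdv (Set.mem_insert _ _)
        fun d' hd' h => (Set.mem_insert_iff.1 hd').resolve_right fun h' => hdS d' h' h
    · rw [Matrix.updateRow_ne hx]
      refine rootedLaplacian_prescribedWeight_congr w fun d' hd' => ?_
      rw [Set.mem_insert_iff, or_iff_right]
      rintro rfl
      exact hx hd'.symm
  have h2 : rootedLaplacian (prescribedWeight w v (insert (hD.reflectDart d) S)) v =
      M.updateRow d.fst (κ • (Pi.single d.fst 1 - Pi.single (hD.reflectVertex d.snd) 1)) := by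
    funext x
    by_cases hx : x = d.fst
    · subst hx
      rw [Matrix.updateRow_self, ← hκ]
      have := rootedLaplacian_prescribedWeight_of_mem w (v := v) (S := insert (hD.reflectDart d) S)
        (d := hD.reflectDart d) (by rwa [ha']) (Set.mem_insert _ _)
        fun d' hd' h => (Set.mem_insert_iff.1 hd').resolve_right
          fun h' => hdS d' h' (h.trans ha')
      rw [ha'] at this
      exact this
    · rw [Matrix.updateRow_ne hx]
      refine rootedLaplacian_prescribedWeight_congr w fun d' hd' => ?_
      rw [Set.mem_insert_iff, or_iff_right]
      rintro rfl
      exact hx (hd'.symm.trans ha')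
  have hsplit : (κ • (Pi.single d.fst 1 - Pi.single d.snd 1) : V → R) =
      κ • (Pi.single d.fst 1 - Pi.single (hD.reflectVertex d.snd) 1) +
        κ • (Pi.single (hD.reflectVertex d.snd) 1 - Pi.single d.snd 1) := by
    rw [← smul_add]
    congr 1
    abel
  rw [h1, h2, hsplit, Matrix.det_updateRow_add, add_eq_left]
  classical
  have hsingle : ∀ b y : V, (Pi.single (hD.reflectVertex b) 1 : V → R) (hD.reflectVertex y) =
      (Pi.single b 1 : V → R) y := by
    intro b y
    simp [Pi.single_apply, hσ.injective.eq_iff]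
  have hsingle' : ∀ b y : V, (Pi.single b 1 : V → R) (hD.reflectVertex y) =
      (Pi.single (hD.reflectVertex b) 1 : V → R) y := by
    intro b y
    rw [← hsingle, hσ]
  refine Matrix.det_eq_zero_of_antisymmetric_row _ hσ
    (Finset.univ.filter fun x => 0 < (D.pos x).2) ?_ ?_ ?_ ha ?_ ?_
  · intro x hx
    simp only [Finset.mem_filter_univ, hD.pos_reflectVertex, Plane.reflect] at hx ⊢
    linarith
  · intro x hx hx'
    simp only [Finset.mem_filter_univ, hD.pos_reflectVertex, Plane.reflect] at hx hx'
    rw [hD.reflectVertex_eq_self_iff]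
    exact le_antisymm (by linarith) (by linarith)
  · intro x y hx
    have h3 : x ≠ d.fst := by
      rintro rfl
      exact hx ha
    have h4 : hD.reflectVertex x ≠ d.fst := fun h => h3 (hσ.injective (h.trans ha.symm))
    rw [Matrix.updateRow_ne h3, Matrix.updateRow_ne h4]
    exact rootedLaplacian_reflectVertex hD hw hv hS hx y
  · intro y
    simp only [Matrix.updateRow_self, Pi.smul_apply, Pi.sub_apply, hsingle, hsingle', smul_eq_mul]
    ring
  · intro y hy
    have := hsingle d.snd y
    rw [hy] at this
    simp [this]

end RootedForest

theorem theorem6p3 {V : Type*} [Fintype V] {R : Type*} [CommRing R]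
    (G : SimpleGraph V) (D : PlaneDrawing G) (hD : D.IsSymmetric)
    (w : G.edgeSet → R) (hw : D.IsSymmetricWeight w)
    (s : ℕ) (E : Fin s → G.Dart)
    (hE_fst : ∀ i, D.OnAxis (E i).fst) (hE_snd : ∀ i, ¬ D.OnAxis (E i).snd)
    (hE_disj : ∀ i j, i ≠ j → ∀ u : V, u ∈ (E i).edge → u ∉ (E j).edge)
    (v : V) (hv_axis : D.OnAxis v) (hv_face : D.OnUnboundedFace v)
    (hv_E : ∀ i, v ∉ (E i).edge) (I J : Finset (Fin s)) :
    ∑ T ∈ rootedTrees hD v E I, SimpleGraph.subgraphWeight w T =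
      ∑ T ∈ rootedTrees hD v E J, SimpleGraph.subgraphWeight w T := by
  classical
  have hfst_mem : ∀ i, (E i).fst ∈ (E i).edge := fun i => Sym2.mem_mk_left _ _
  have hfst_inj : ∀ {i j}, (E i).fst = (E j).fst → i = j := by
    intro i j h
    by_contra hij
    exact hE_disj i j hij _ (hfst_mem i) (h ▸ hfst_mem j)
  have hrefl : ∀ i, (hD.reflectDart (E i)).fst = (E i).fst :=
    fun i => (hD.reflectVertex_eq_self_iff _).2 (hE_fst i)
  -- `e I` lists the oriented edges prescribed by `I`.
  let e : Finset (Fin s) → Fin s → G.Dart := fun I i => if i ∈ I then E i else hD.reflectDart (E i)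
  have he_fst : ∀ I i, (e I i).fst = (E i).fst := by
    intro I i
    by_cases hi : i ∈ I
    · simp [e, hi]
    · simp [e, hi, hrefl]
  have hdet : ∀ I, ∑ T ∈ rootedTrees hD v E I, SimpleGraph.subgraphWeight w T =
      (RootedForest.rootedLaplacian
        (RootedForest.prescribedWeight w v (Set.range (e I))) v).det := by
    intro I
    refine RootedForest.sum_rootedTrees_eq_det w v (Set.range (e I)) ?_ _ fun T => ?_
    rotate_left
    · refine Finset.mem_filter.trans ((and_iff_right (Finset.mem_univ T)).trans ?_)
      refine and_congr_right fun _ => ?_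
      rw [Set.forall_mem_range, ← forall_and]
      refine forall_congr' fun i => ?_
      by_cases hi : i ∈ I <;> simp [e, hi]
    · rintro _ ⟨i, rfl⟩ h
      exact hv_E i (h ▸ he_fst I i ▸ hfst_mem i)
  suffices h : ∀ I, ∑ T ∈ rootedTrees hD v E I, SimpleGraph.subgraphWeight w T =
      ∑ T ∈ rootedTrees hD v E ∅, SimpleGraph.subgraphWeight w T from (h I).trans (h J).symm
  intro I
  induction I using Finset.induction_on with
  | empty => rfl
  | insert i I hi ih =>
    rw [← ih, hdet, hdet]
    have hins : ∀ I' : Finset (Fin s), (∀ j, j ≠ i → (j ∈ I' ↔ j ∈ I)) →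
        Set.range (e I') = insert (e I' i) (e I '' {j | j ≠ i}) := by
      intro I' hI'
      have h : e I '' {j | j ≠ i} = e I' '' {j | j ≠ i} :=
        Set.image_congr fun j hj => by simp [e, hI' j hj]
      rw [h, ← Set.image_univ, ← Set.image_insert_eq]
      congr 1
      ext j
      simp [em]
    rw [hins (insert i I) fun j hj => by simp [hj], hins I fun j _ => Iff.rfl]
    have h1 : e (insert i I) i = E i := by simp [e]
    have h2 : e I i = hD.reflectDart (E i) := by simp [e, hi]
    rw [h1, h2]
    refine RootedForest.det_rootedLaplacian_reflectDart hD hw hv_axis ?_ (hE_fst i) ?_ ?_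
    · rintro _ ⟨j, -, rfl⟩
      rw [he_fst]
      exact hE_fst j
    · exact fun h => hv_E i (h ▸ hfst_mem i)
    · rintro _ ⟨j, hj, rfl⟩ h
      rw [he_fst] at h
      exact hj (hfst_inj h)
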